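/- Let $K$ be a number field with ring of integers $\mathcal{O}_K$, let $f \in \mathcal{O}_K[X]$ be a square-free monic polynomial of odd degree at least $3$, and let $S$ be a finite set of nonzero prime ideals of $\mathcal{O}_K$. Let $$\mathcal{O}_{K,S} = \{x \in K : \nu_{\mathfrak{p}}(x) \ge 0 \text{ for every nonzero prime ideal } \mathfrak{p} \notin S\}$$ be the ring of $S$-integers of $K$, and put $$A_S = \mathcal{O}_{K,S}[X,Y]/\langle Y^2-f(X)\rangle, \qquad A_K = K[X,Y]/\langle Y^2-f(X)\rangle .$$ Restriction to the generic fibre, that is, $[M] \mapsto [A_K \otimes_{A_S} M]$ for invertible $A_S$-modules $M$ (where $A_S \to A_K$ is induced by the inclusion $\mathcal{O}_{K,S} \subset K$), gives a homomorphism of abelian groups $$\theta \colon \mathrm{Pic}(A_S) \longrightarrow \mathrm{Pic}(A_K).$$ Moreover: (1) if $S$ contains all the prime ideals of $\mathcal{O}_K$ dividing $2\,\mathrm{disc}(f)$, then $\theta$ is surjective; (2) if $\mathcal{O}_{K,S}$ is a principal ideal domain, then $\theta$ is injective. -/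

import Mathlib

open Polynomial
open scoped NumberField TensorProduct

universe u

/-- The affine coordinate ring `T[X, Y] / (Y² - f(X))` of the curve `Y² = f(X)` over an
`R`-algebra `T`, where `f ∈ R[X]`. The outer variable of `T[X][Y]` plays the role of `Y`. -/
noncomputable abbrev CurveRing {R : Type*} [CommRing R] (f : R[X]) (T : Type*) [CommRing T]
    [Algebra R T] : Type _ :=
  AdjoinRoot ((X : T[X][X]) ^ 2 - C (f.map (algebraMap R T)))

/-- The ring homomorphism `T[X, Y] / (Y² - f(X)) → T'[X, Y] / (Y² - f(X))` that a homomorphism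
`φ : T → T'` of `R`-algebras induces: it is `φ` on `T` and sends `X` to `X` and `Y` to `Y`. -/
noncomputable def CurveRing.map {R : Type*} [CommRing R] (f : R[X]) {T T' : Type*} [CommRing T]
    [CommRing T'] [Algebra R T] [Algebra R T'] (φ : T →ₐ[R] T') :
    CurveRing f T →+* CurveRing f T' :=
  AdjoinRoot.map (Polynomial.mapRingHom (φ : T →+* T')) _ _ (by
    have h : (φ : T →+* T').comp (algebraMap R T) = algebraMap R T' := φ.comp_algebraMap
    simp [Polynomial.map_map, h])

/-- The homomorphism `O_{K,S}[X, Y] / (Y² - f(X)) → K[X, Y] / (Y² - f(X))` that the inclusion of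
the ring of `S`-integers `O_{K,S}` in `K` induces. On spectra it is the inclusion of the generic
fibre. -/
noncomputable def genericFibreHom {K : Type*} [Field K] [NumberField K] (f : (𝓞 K)[X])
    (S : Set (IsDedekindDomain.HeightOneSpectrum (𝓞 K))) :
    CurveRing f (S.integer K) →+* CurveRing f K :=
  CurveRing.map f (S.integer K).val

/-!
Write `A_S` and `A_K` for the coordinate rings over the `S`-integers and over `K`. They are domains,
because `a ^ 2 - f b ^ 2 ≠ 0` for `(a, b) ≠ 0` by parity of degrees, and `A_K` is the localization
of `A_S` at the nonzero `S`-integers.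

Surjectivity: an invertible `A_K`-module is isomorphic to an invertible ideal `I` of `A_K`, and it
comes from the contraction `I ∩ A_S`, provided this ideal is invertible, that is, locally principal.
At a prime over `(0)` this is inherited from `I`. At a prime over `p ≠ (0)`, the image of `I ∩ A_S`
in the fibre over `p` is locally principal, because the fibre is the curve over a field in which
`2 disc(f) ≠ 0`, hence has a Dedekind coordinate ring; by Nakayama's lemma a local generator lifts,
since `I ∩ A_S` is saturated with respect to a uniformizer of `p`.

Injectivity: a class in the kernel is represented by an ideal dividing `(n)` for some nonzero
`S`-integer `n`. The fibres being domains, the prime factors of `n` stay prime in `A_S`, and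
removing them one at a time shows that the ideal is principal.
-/

open scoped nonZeroDivisors

section LocallyPrincipal

variable {A : Type*} [CommRing A]

/-- The ideal `I` is *principal near* the prime ideal `P` if the localization `I_P` is a principal
ideal of `A_P`, stated without localizing: some `b ∈ I` divides every element of `I` up to a factor
outside `P`. -/
def IsPrincipalNear (I P : Ideal A) : Prop :=
  ∃ b ∈ I, ∀ x ∈ I, ∃ r ∉ P, b ∣ r * x

theorem exists_notMem_dvd_mul_of_mem_span {P : Ideal A} [hP : P.IsPrime] {b : A} {s : Set A}
    (hs : ∀ x ∈ s, ∃ r ∉ P, b ∣ r * x) {x : A} (hx : x ∈ Ideal.span s) :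
    ∃ r ∉ P, b ∣ r * x := by
  induction hx using Submodule.span_induction with
  | mem x hx => exact hs x hx
  | zero => exact ⟨1, hP.one_notMem, by simp⟩
  | add x y _ _ hx hy =>
    obtain ⟨r, hr, hbx⟩ := hx
    obtain ⟨t, ht, hby⟩ := hy
    refine ⟨r * t, hP.mul_notMem hr ht, ?_⟩
    rw [show r * t * (x + y) = r * x * t + t * y * r by ring]
    exact dvd_add (hbx.mul_right t) (hby.mul_right r)
  | smul a x _ hx =>
    obtain ⟨r, hr, hbx⟩ := hx
    exact ⟨r, hr, by rw [smul_eq_mul, mul_left_comm]; exact hbx.mul_left a⟩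

theorem IsPrincipalNear.map {B : Type*} [CommRing B] (f : A →+* B) {I : Ideal A} {P : Ideal B}
    [P.IsPrime] (h : IsPrincipalNear I (P.comap f)) : IsPrincipalNear (I.map f) P := by
  obtain ⟨b, hb, hdvd⟩ := h
  refine ⟨f b, Ideal.mem_map_of_mem f hb, fun x => exists_notMem_dvd_mul_of_mem_span ?_⟩
  rintro _ ⟨y, hy, rfl⟩
  obtain ⟨r, hr, hby⟩ := hdvd y hy
  exact ⟨f r, hr, map_mul f r y ▸ map_dvd f hby⟩

theorem IsPrincipalNear.exists_forall_dvd {I P : Ideal A} [hP : P.IsPrime] (hI : I.FG)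
    (h : IsPrincipalNear I P) : ∃ b ∈ I, ∃ r ∉ P, ∀ x ∈ I, b ∣ r * x := by
  classical
  obtain ⟨b, hb, hdvd⟩ := h
  obtain ⟨s, rfl⟩ := hI
  choose! r hrP hr using hdvd
  refine ⟨b, hb, ∏ x ∈ s, r x, fun hmem => ?_, ?_⟩
  · obtain ⟨x, hx, hrx⟩ := hP.prod_mem_iff.mp hmem
    exact hrP x (Ideal.subset_span hx) hrx
  · suffices Ideal.span s ≤
        Submodule.comap (LinearMap.mulLeft A (∏ x ∈ s, r x)) (Ideal.span {b}) from
      fun x hx => Ideal.mem_span_singleton.mp (this hx)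
    refine Ideal.span_le.mpr fun x hx => Ideal.mem_span_singleton.mpr ?_
    rw [LinearMap.mulLeft_apply, ← Finset.prod_erase_mul s r hx, mul_assoc]
    exact (hr x (Ideal.subset_span hx)).mul_left _

theorem IsPrincipalNear.comap_of_isLocalization {B : Type*} [CommRing B] [Algebra A B]
    (M : Submonoid A) [IsLocalization M B] {I P : Ideal B} [hP : P.IsPrime]
    (h : IsPrincipalNear I P) :
    IsPrincipalNear (I.comap (algebraMap A B)) (P.comap (algebraMap A B)) := by
  have hM (c : M) : (c : A) ∉ P.comap (algebraMap A B) := fun hc =>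
    hP.ne_top (Ideal.eq_top_of_isUnit_mem P hc (IsLocalization.map_units B c))
  obtain ⟨b, hb, hdvd⟩ := h
  obtain ⟨⟨b', d⟩, hbd⟩ := IsLocalization.surj M b
  refine ⟨b', Ideal.mem_comap.mpr (hbd ▸ I.mul_mem_right _ hb), fun x hx => ?_⟩
  obtain ⟨r, hr, y, hy⟩ := hdvd _ hx
  obtain ⟨⟨r', e⟩, hre⟩ := IsLocalization.surj M r
  obtain ⟨⟨y', c⟩, hyc⟩ := IsLocalization.surj M y
  have hr' : r' ∉ P.comap (algebraMap A B) := fun h =>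
    hP.mul_notMem hr (hM e) (hre ▸ h : r * algebraMap A B e ∈ P)
  obtain ⟨k, hk⟩ : ∃ k : M, k * (c * d * r' * x) = k * (b' * (y' * e)) := by
    refine IsLocalization.exists_of_eq (S := B) ?_
    simp only [map_mul, ← hbd, ← hre, ← hyc]
    linear_combination (algebraMap A B e * algebraMap A B c * algebraMap A B d) * hy
  have hPA : (P.comap (algebraMap A B)).IsPrime := Ideal.comap_isPrime _ P
  refine ⟨k * (c * d * r'), hPA.mul_notMem (hM k)
    (hPA.mul_notMem (hPA.mul_notMem (hM c) (hM d)) hr'), k * (y' * e), ?_⟩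
  linear_combination hk

theorem isPrincipalNear_of_le_span_singleton_sup {I P : Ideal A} (hI : I.FG) (hP : P ≠ ⊤) {b : A}
    (hb : b ∈ I) (hle : I ≤ Ideal.span {b} ⊔ P * I) : IsPrincipalNear I P := by
  obtain ⟨r, hr, hrI⟩ := Submodule.exists_sub_one_mem_and_smul_le_of_fg_of_le_sup hI le_rfl hle
  refine ⟨b, hb, fun x hx => ⟨r, fun hrP => ?_, Ideal.mem_span_singleton.mp ?_⟩⟩
  · exact (Ideal.ne_top_iff_one P).mp hP (by simpa using sub_mem hrP hr)
  · exact hrI (Submodule.smul_mem_pointwise_smul x r I hx)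

/-- Saturation lets one divide by `ϖ` inside `I`, so a generator modulo `ker π`
generates `I` modulo `m * I`, and Nakayama's lemma applies. -/
theorem isPrincipalNear_of_map {D : Type*} [CommRing D] {π : A →+* D}
    (hπ : Function.Surjective π) {I m : Ideal A} [hm : m.IsMaximal] (hI : I.FG) {ϖ : A}
    (hϖ : ϖ ∈ m) (hker : ∀ x ∈ RingHom.ker π, ∃ t ∉ m, ϖ ∣ t * x)
    (hsat : ∀ x, ϖ * x ∈ I → x ∈ I) (hmap : IsPrincipalNear (I.map π) (m.map π)) :
    IsPrincipalNear I m := by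
  obtain ⟨_, hπb, hdvd⟩ := hmap
  obtain ⟨b, hb, rfl⟩ := (Ideal.mem_map_iff_of_surjective π hπ).mp hπb
  refine isPrincipalNear_of_le_span_singleton_sup hI hm.ne_top hb fun x hx => ?_
  obtain ⟨c₀, hc₀, z₀, hz₀⟩ := hdvd _ (Ideal.mem_map_of_mem π hx)
  obtain ⟨c, rfl⟩ := hπ c₀
  obtain ⟨z, rfl⟩ := hπ z₀
  obtain ⟨t, ht, w, hw⟩ := hker (c * x - b * z) (by
    rw [RingHom.mem_ker, map_sub, map_mul, map_mul, hz₀, sub_self])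
  have hwI : w ∈ I := hsat w <|
    hw ▸ I.mul_mem_left _ (sub_mem (I.mul_mem_left _ hx) (I.mul_mem_right _ hb))
  have hc : c ∉ m := fun h => hc₀ (Ideal.mem_map_of_mem π h)
  obtain ⟨s, n, hn, hs⟩ := hm.exists_inv (hm.isPrime.mul_notMem ht hc)
  have hx_eq : x = b * (s * t * z) + (s * ϖ * w + n * x) := by
    linear_combination (-x) * hs + s * hw
  rw [hx_eq]
  exact add_mem (Ideal.mem_sup_left (Ideal.mem_span_singleton.mpr ⟨_, rfl⟩))
    (Ideal.mem_sup_right (add_mem (Ideal.mul_mem_mul (m.mul_mem_left s hϖ) hwI)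
      (Ideal.mul_mem_mul hn hx)))

theorem isDiscreteValuationRing_atPrime_of_isPrincipalNear [IsDomain A] [IsNoetherianRing A]
    {P : Ideal A} [P.IsPrime] (hP : P ≠ ⊥) (h : IsPrincipalNear P P) :
    IsDiscreteValuationRing (Localization.AtPrime P) := by
  obtain ⟨b, hb, hdvd⟩ := h
  have : IsNoetherianRing (Localization.AtPrime P) :=
    IsLocalization.isNoetherianRing P.primeCompl _ inferInstance
  refine ((IsDiscreteValuationRing.TFAE _
    (IsLocalization.AtPrime.not_isField A hP (Localization.AtPrime P))).out 0 4).mpr ?_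
  refine ⟨algebraMap A _ b, le_antisymm ?_ ?_⟩
  · rw [← Localization.AtPrime.map_eq_maximalIdeal, Ideal.map_le_iff_le_comap]
    intro x hx
    obtain ⟨r, hr, hbx⟩ := hdvd x hx
    have hunit := IsLocalization.map_units (Localization.AtPrime P) (⟨r, hr⟩ : P.primeCompl)
    refine Ideal.mem_comap.mpr (Ideal.mem_span_singleton.mpr (hunit.dvd_mul_left.mp ?_))
    rw [← map_mul]
    exact map_dvd _ hbx
  · rw [Ideal.submodule_span_eq, Ideal.span_singleton_le_iff_mem,
      ← Localization.AtPrime.map_eq_maximalIdeal]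
    exact Ideal.mem_map_of_mem _ hb

theorem isDedekindDomain_of_isPrincipalNear_self [IsDomain A] [IsNoetherianRing A]
    (h : ∀ P : Ideal A, P.IsPrime → P ≠ ⊥ → IsPrincipalNear P P) : IsDedekindDomain A :=
  have : IsDedekindDomainDvr A := { is_dvr_at_nonzero_prime := fun P hP hprime =>
    isDiscreteValuationRing_atPrime_of_isPrincipalNear hP (h P hprime hP) }
  inferInstance

end LocallyPrincipal

section InvertibleIdeal

variable {A : Type*} [CommRing A]

/-- An ideal of a domain is *invertible* if it divides a nonzero principal ideal. This is
invertibility as a fractional ideal, without mention of a field of fractions. -/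
def IsInvertibleIdeal (I : Ideal A) : Prop :=
  ∃ (J : Ideal A) (a : A), a ≠ 0 ∧ I * J = Ideal.span {a}

theorem IsInvertibleIdeal.ne_bot {I : Ideal A} (h : IsInvertibleIdeal I) : I ≠ ⊥ := by
  rintro rfl
  obtain ⟨J, a, ha, hIJ⟩ := h
  rw [Ideal.bot_mul, eq_comm, Ideal.span_singleton_eq_bot] at hIJ
  exact ha hIJ

variable [IsDomain A]

theorem IsInvertibleIdeal.invertible {I : Ideal A} (h : IsInvertibleIdeal I) :
    Module.Invertible A I := by
  obtain ⟨J, a, ha, hIJ⟩ := h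
  let F := FractionRing A
  have haF : algebraMap A F a ≠ 0 := by simpa using ha
  have hinj : Function.Injective (Algebra.linearMap A F) := FaithfulSMul.algebraMap_injective A F
  have hmap_mul : Submodule.map (Algebra.linearMap A F) (I * J) =
      Submodule.map (Algebra.linearMap A F) I * Submodule.map (Algebra.linearMap A F) J :=
    Submodule.map_mul I J (Algebra.ofId A F)
  have hunit : Submodule.map (Algebra.linearMap A F) I *
      (Submodule.span A {(algebraMap A F a)⁻¹} * Submodule.map (Algebra.linearMap A F) J) = 1 := by
    rw [mul_left_comm, ← hmap_mul, hIJ, Ideal.span, LinearMap.map_span, Set.image_singleton,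
      Submodule.span_mul_span, Submodule.one_eq_span, Set.singleton_mul_singleton,
      Algebra.linearMap_apply, inv_mul_cancel₀ haF]
  have e : I ≃ₗ[A] (Units.mkOfMulEqOne _ _ hunit : (Submodule A F)ˣ).1 :=
    Submodule.equivMapOfInjective (Algebra.linearMap A F) hinj I
  exact .congr e.symm

theorem IsInvertibleIdeal.isPrincipalNear {I P : Ideal A} (hP : P ≠ ⊤)
    (h : IsInvertibleIdeal I) : IsPrincipalNear I P := by
  obtain ⟨J, a, ha, hIJ⟩ := h
  have hdvd {x y : A} (hx : x ∈ I) (hy : y ∈ J) : a ∣ x * y :=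
    Ideal.mem_span_singleton.mp (hIJ ▸ Ideal.mul_mem_mul hx hy)
  obtain ⟨x, hx, y, hy, r, hr, hxy⟩ : ∃ x ∈ I, ∃ y ∈ J, ∃ r ∉ P, x * y = a * r := by
    by_contra! hcon
    have hle : I * J ≤ Ideal.span {a} * P := Ideal.mul_le.mpr fun x hx y hy => by
      obtain ⟨r, hr⟩ := hdvd hx hy
      refine Ideal.mem_span_singleton_mul.mpr ⟨r, ?_, hr.symm⟩
      exact not_not.mp fun hrP => hcon x hx y hy r hrP hr
    obtain ⟨r, hr, hra⟩ := Ideal.mem_span_singleton_mul.mp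
      (hle (hIJ ▸ Ideal.mem_span_singleton_self a))
    rw [mul_eq_left₀ ha] at hra
    exact (Ideal.ne_top_iff_one P).mp hP (hra ▸ hr)
  refine ⟨x, hx, fun z hz => ⟨r, hr, ?_⟩⟩
  obtain ⟨s, hs⟩ := hdvd hz hy
  exact ⟨s, mul_left_cancel₀ ha (by linear_combination (-z) * hxy + x * hs)⟩

theorem isInvertibleIdeal_of_isPrincipalNear {I : Ideal A} (hI : I ≠ ⊥) (hfg : I.FG)
    (h : ∀ m : Ideal A, m.IsMaximal → IsPrincipalNear I m) : IsInvertibleIdeal I := by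
  obtain ⟨a, haI, ha⟩ := Submodule.exists_mem_ne_zero_of_ne_bot hI
  let J : Ideal A := (Ideal.span {a}).colon I
  have hJ (y : A) : y ∈ J ↔ ∀ x ∈ I, a ∣ y * x := by
    simp only [J, Submodule.mem_colon, SetLike.mem_coe, smul_eq_mul, Ideal.mem_span_singleton]
  refine ⟨J, a, ha, le_antisymm ?_ ?_⟩
  · refine Ideal.mul_le.mpr fun x hx y hy => Ideal.mem_span_singleton.mpr ?_
    exact mul_comm x y ▸ (hJ y).mp hy x hx
  · rw [Ideal.span_singleton_le_iff_mem]
    by_contra haIJ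
    obtain ⟨m, hm, hle⟩ := Ideal.exists_le_maximal ((I * J).colon {a}) (by
      rwa [Ne, Ideal.eq_top_iff_one, Submodule.mem_colon_singleton, one_smul])
    obtain ⟨b, hb, r, hr, hdvd⟩ := (h m hm).exists_forall_dvd hfg
    obtain ⟨s, hs⟩ := hdvd a haI
    have hb0 : b ≠ 0 := by
      rintro rfl
      exact mul_ne_zero (fun h0 : r = 0 => hr (h0 ▸ m.zero_mem)) ha (by rw [hs, zero_mul])
    have hsJ : s ∈ J := (hJ s).mpr fun x hx => by
      obtain ⟨t, ht⟩ := hdvd x hx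
      exact ⟨t, mul_left_cancel₀ hb0 (by linear_combination a * ht - x * hs)⟩
    refine hr (hle (Submodule.mem_colon_singleton.mpr ?_))
    rw [smul_eq_mul, hs]
    exact Ideal.mul_mem_mul hb hsJ

theorem isInvertibleIdeal_of_isDedekindDomain {D : Type*} [CommRing D] [IsDedekindDomain D]
    {I : Ideal D} (hI : I ≠ ⊥) : IsInvertibleIdeal I := by
  obtain ⟨a, haI, ha⟩ := Submodule.exists_mem_ne_zero_of_ne_bot hI
  obtain ⟨J, hJ⟩ := Ideal.dvd_span_singleton.mpr haI
  exact ⟨J, a, ha, hJ.symm⟩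

theorem isPrincipalNear_of_isDedekindDomain {D : Type*} [CommRing D] [IsDedekindDomain D]
    (I : Ideal D) {P : Ideal D} (hP : P ≠ ⊤) : IsPrincipalNear I P := by
  rcases eq_or_ne I ⊥ with rfl | hI
  · exact ⟨0, Ideal.zero_mem _, fun x hx => ⟨1, (Ideal.ne_top_iff_one P).mp hP, by simp_all⟩⟩
  · exact (isInvertibleIdeal_of_isDedekindDomain hI).isPrincipalNear hP

theorem isPrincipalNear_comap_of_isDedekindDomain_fibre {R A B : Type*} [CommRing R]
    [IsDedekindDomain R] [CommRing A] [CommRing B] [Algebra R A] [Algebra A B] [IsNoetherianRing A]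
    [IsLocalization (Algebra.algebraMapSubmonoid A R⁰) B] (I : Ideal B) {m : Ideal A}
    [hm : m.IsMaximal] (hne : m.comap (algebraMap R A) ≠ ⊥)
    [IsDedekindDomain (A ⧸ (m.comap (algebraMap R A)).map (algebraMap R A))] :
    IsPrincipalNear (I.comap (algebraMap A B)) m := by
  let p := m.comap (algebraMap R A)
  have hp : p.IsPrime := Ideal.comap_isPrime _ m
  let π := Ideal.Quotient.mk (p.map (algebraMap R A))
  have hπ : Function.Surjective π := Ideal.Quotient.mk_surjective
  have hker : RingHom.ker π = p.map (algebraMap R A) := Ideal.mk_ker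
  obtain ⟨ϖ, hϖ, hdvd⟩ := isPrincipalNear_of_isDedekindDomain p hp.ne_top
  have hϖ0 : ϖ ≠ 0 := by
    rintro rfl
    obtain ⟨y, hy, hy0⟩ := Submodule.exists_mem_ne_zero_of_ne_bot hne
    obtain ⟨t, ht, hty⟩ := hdvd y hy
    exact mul_ne_zero (fun h0 : t = 0 => ht (h0 ▸ p.zero_mem)) hy0 (zero_dvd_iff.mp hty)
  have hunit : IsUnit (algebraMap A B (algebraMap R A ϖ)) :=
    IsLocalization.map_units B
      (⟨_, ϖ, mem_nonZeroDivisors_of_ne_zero hϖ0, rfl⟩ : Algebra.algebraMapSubmonoid A R⁰)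
  have hmπ : m.map π ≠ ⊤ := fun htop => hm.ne_top <| by
    rw [← sup_eq_left.mpr (hker.le.trans Ideal.map_comap_le : RingHom.ker π ≤ m),
      ← Ideal.comap_map_of_surjective' π hπ, htop, Ideal.comap_top]
  refine isPrincipalNear_of_map hπ (IsNoetherian.noetherian _) (ϖ := algebraMap R A ϖ) hϖ
    (fun x hx => ?_) (fun x hx => ?_) (isPrincipalNear_of_isDedekindDomain _ hmπ)
  · refine exists_notMem_dvd_mul_of_mem_span ?_ (hker ▸ hx : x ∈ p.map (algebraMap R A))
    rintro _ ⟨y, hy, rfl⟩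
    obtain ⟨t, ht, hty⟩ := hdvd y hy
    exact ⟨algebraMap R A t, ht, map_mul (algebraMap R A) t y ▸ map_dvd (algebraMap R A) hty⟩
  · rw [Ideal.mem_comap, map_mul] at hx
    exact (I.unit_mul_mem_iff_mem hunit).mp hx

theorem IsInvertibleIdeal.comap_of_isDedekindDomain_fibre {R B : Type*} [CommRing R]
    [IsDedekindDomain R] [CommRing B] [IsDomain B] [Algebra R A] [Algebra A B] [IsNoetherianRing A]
    [IsLocalization (Algebra.algebraMapSubmonoid A R⁰) B]
    (hfibre : ∀ p : Ideal R, p.IsPrime → p ≠ ⊥ →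
      IsDedekindDomain (A ⧸ p.map (algebraMap R A)))
    {I : Ideal B} (hI : IsInvertibleIdeal I) :
    IsInvertibleIdeal (I.comap (algebraMap A B)) := by
  let M := Algebra.algebraMapSubmonoid A R⁰
  have hfg : (I.comap (algebraMap A B)).FG := IsNoetherian.noetherian _
  refine isInvertibleIdeal_of_isPrincipalNear (fun h0 => hI.ne_bot ?_) hfg fun m hm => ?_
  · rw [← IsLocalization.map_under M B I, Ideal.under_def, h0, Ideal.map_bot]
  let p := m.comap (algebraMap R A)
  have hp : p.IsPrime := Ideal.comap_isPrime _ m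
  rcases eq_or_ne p ⊥ with hbot | hne
  · have hdisj : Disjoint (M : Set A) m := by
      rw [Set.disjoint_left]
      rintro _ ⟨r, hr, rfl⟩ hrm
      exact nonZeroDivisors.ne_zero hr (Ideal.mem_bot.mp (hbot ▸ hrm : r ∈ (⊥ : Ideal R)))
    have hmB := IsLocalization.isPrime_of_isPrime_disjoint M B m hm.isPrime hdisj
    rw [← IsLocalization.under_map_of_isPrime_disjoint M B hm.isPrime hdisj]
    exact (hI.isPrincipalNear hmB.ne_top).comap_of_isLocalization M
  · have := hfibre p hp hne
    exact isPrincipalNear_comap_of_isDedekindDomain_fibre I hne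

end InvertibleIdeal

section Pic

open CommRing (Pic relPic)

open scoped Pointwise in
theorem exists_ideal_mul_eq_span_of_submodule_units {A B : Type*} [CommRing A] [CommRing B]
    [Algebra A B] [FaithfulSMul A B] (M : Submonoid A) [IsLocalization M B]
    (U : (Submodule A B)ˣ) :
    ∃ (I J : Ideal A) (d : A), d ∈ M ∧ I * J = Ideal.span {d} ∧ Nonempty (U.1 ≃ₗ[A] I) := by
  let V : FractionalIdeal M B := ⟨U.1, U.submodule_isFractional (S := M)⟩
  let W : FractionalIdeal M B := ⟨(U⁻¹).1, (U⁻¹).submodule_isFractional (S := M)⟩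
  refine ⟨V.num, W.num, V.den * W.den, mul_mem V.den.2 W.den.2, ?_,
    ⟨FractionalIdeal.equivNumOfIsLocalization V⟩⟩
  have hinj : Function.Injective (Algebra.linearMap A B) := FaithfulSMul.algebraMap_injective A B
  have hVW : (V : Submodule A B) * (W : Submodule A B) = 1 := U.mul_inv
  refine Submodule.map_injective_of_injective hinj ?_
  calc Submodule.map (Algebra.linearMap A B) (V.num * W.num)
      = Submodule.map (Algebra.linearMap A B) V.num *
          Submodule.map (Algebra.linearMap A B) W.num :=
        Submodule.map_mul V.num W.num (Algebra.ofId A B)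
    _ = ((V.den : A) * W.den) • (1 : Submodule A B) := by
        rw [← FractionalIdeal.den_mul_self_eq_num, ← FractionalIdeal.den_mul_self_eq_num,
          Submonoid.smul_def, Submonoid.smul_def, smul_mul_smul_comm, hVW]
    _ = Submodule.map (Algebra.linearMap A B) (Ideal.span {(V.den : A) * W.den}) := by
        rw [Submodule.one_eq_span, Ideal.span, LinearMap.map_span, Set.image_singleton,
          Submodule.smul_span, Set.smul_set_singleton, Algebra.smul_def, mul_one,
          Algebra.linearMap_apply]

theorem exists_eq_span_singleton_mul {A : Type*} [CommRing A] {I : Ideal A} {p : A}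
    (hI : I ≤ Ideal.span {p}) : ∃ I' : Ideal A, I = Ideal.span {p} * I' := by
  refine ⟨Submodule.comap (LinearMap.mulLeft A p) I, le_antisymm (fun x hx => ?_) ?_⟩
  · obtain ⟨z, rfl⟩ := Ideal.mem_span_singleton.mp (hI hx)
    exact Ideal.mem_span_singleton_mul.mpr ⟨z, hx, rfl⟩
  · exact Ideal.span_singleton_mul_le_iff.mpr fun z hz => hz

theorem isPrincipal_of_mul_eq_span_algebraMap {R A : Type*} [CommRing R]
    [UniqueFactorizationMonoid R] [CommRing A] [IsDomain A] [Algebra R A]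
    (hprime : ∀ p : R, Prime p → Prime (algebraMap R A p)) {n : R} (hn : n ≠ 0) {I J : Ideal A}
    (h : I * J = Ideal.span {algebraMap R A n}) : I.IsPrincipal := by
  induction n using UniqueFactorizationMonoid.induction_on_prime generalizing I J with
  | h₁ => exact absurd rfl hn
  | h₂ x hx =>
    have htop : I * J = ⊤ := h.trans (Ideal.span_singleton_eq_top.mpr (hx.map (algebraMap R A)))
    rw [top_le_iff.mp (htop ▸ Ideal.mul_le_left : ⊤ ≤ I)]
    infer_instance
  | h₃ a p ha hp ih =>
    have hq := hprime p hp
    rw [map_mul, ← Ideal.span_singleton_mul_span_singleton] at h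
    have hle : I * J ≤ Ideal.span {algebraMap R A p} := h ▸ Ideal.mul_le_left
    rcases (((Ideal.span_singleton_prime hq.ne_zero).mpr hq).mul_le).mp hle with hI | hJ
    · obtain ⟨I', rfl⟩ := exists_eq_span_singleton_mul hI
      rw [mul_assoc, Ideal.span_singleton_mul_right_inj hq.ne_zero] at h
      obtain ⟨z, rfl⟩ := (ih ha h).principal
      exact ⟨algebraMap R A p * z, Ideal.span_singleton_mul_span_singleton _ _⟩
    · obtain ⟨J', rfl⟩ := exists_eq_span_singleton_mul hJ
      rw [mul_left_comm, Ideal.span_singleton_mul_right_inj hq.ne_zero] at h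
      exact ih ha h

variable {R A B : Type*} [CommRing R] [CommRing A] [CommRing B] [Algebra R A] [Algebra A B]

theorem pic_mapAlgebra_mk (M : Type*) [AddCommGroup M] [Module A M] [Module.Invertible A M] :
    Pic.mapAlgebra A B (Pic.mk A M) = Pic.mk B (B ⊗[A] M) := by
  rw [Pic.mapAlgebra_apply, Pic.mk_eq_mk_iff]
  exact ⟨TensorProduct.AlgebraTensorModule.congr (.refl ..) (Pic.mk.linearEquiv ..)⟩

theorem exists_isInvertibleIdeal_pic_mk_eq [IsDomain A] (N : Pic A) :
    ∃ (I : Ideal A) (_ : Module.Invertible A I), IsInvertibleIdeal I ∧ Pic.mk A I = N := by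
  have hN : N ∈ relPic A (FractionRing A) := Subsingleton.elim ..
  rw [← Submodule.range_unitsToPic] at hN
  obtain ⟨U, rfl⟩ := hN
  obtain ⟨I, J, a, ha, h, ⟨e⟩⟩ := exists_ideal_mul_eq_span_of_submodule_units A⁰ U
  have hI : Module.Invertible A I := .congr e
  refine ⟨I, hI, ⟨J, a, nonZeroDivisors.ne_zero ha, h⟩, ?_⟩
  rw [Submodule.unitsToPic_apply, Pic.mk_eq_mk_iff]
  exact ⟨e.symm⟩

theorem pic_mapAlgebra_injective [IsDomain R] [UniqueFactorizationMonoid R] [IsDomain A]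
    [FaithfulSMul R A] [FaithfulSMul A B] [IsLocalization (Algebra.algebraMapSubmonoid A R⁰) B]
    (hprime : ∀ p : R, Prime p → Prime (algebraMap R A p)) :
    Function.Injective (Pic.mapAlgebra A B) := by
  rw [injective_iff_map_eq_one]
  intro N hN
  have hN : N ∈ relPic A B := hN
  rw [← Submodule.range_unitsToPic] at hN
  obtain ⟨U, rfl⟩ := hN
  obtain ⟨I, J, _, ⟨n, hn, rfl⟩, h, ⟨e⟩⟩ :=
    exists_ideal_mul_eq_span_of_submodule_units (Algebra.algebraMapSubmonoid A R⁰) U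
  have hn0 : n ≠ 0 := nonZeroDivisors.ne_zero hn
  have hI : IsInvertibleIdeal I := ⟨J, _, by simpa using hn0, h⟩
  obtain ⟨x, rfl⟩ := (isPrincipal_of_mul_eq_span_algebraMap hprime hn0 h).principal
  have hx : x ≠ 0 := fun hx => hI.ne_bot (Ideal.span_singleton_eq_bot.mpr hx)
  rw [Submodule.unitsToPic_apply, Pic.mk_eq_one_iff]
  exact ⟨e ≪≫ₗ (LinearEquiv.toSpanNonzeroSingleton A A x hx).symm⟩

theorem pic_mapAlgebra_surjective [IsDedekindDomain R] [IsDomain A] [IsNoetherianRing A]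
    [IsDomain B] [IsLocalization (Algebra.algebraMapSubmonoid A R⁰) B]
    (hfibre : ∀ p : Ideal R, p.IsPrime → p ≠ ⊥ →
      IsDedekindDomain (A ⧸ p.map (algebraMap R A))) :
    Function.Surjective (Pic.mapAlgebra A B) := by
  intro N
  obtain ⟨I, _, hI, rfl⟩ := exists_isInvertibleIdeal_pic_mk_eq N
  let M := Algebra.algebraMapSubmonoid A R⁰
  let I' := I.comap (algebraMap A B)
  have : Module.Invertible A I' := (hI.comap_of_isDedekindDomain_fibre hfibre).invertible
  refine ⟨Pic.mk A I', ?_⟩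
  rw [pic_mapAlgebra_mk, Pic.mk_eq_mk_iff]
  have hbc : IsBaseChange B (Submodule.toLocalized' (S := B) M (Algebra.linearMap A B) I') :=
    (isLocalizedModule_iff_isBaseChange M B _).mp inferInstance
  refine ⟨hbc.equiv ≪≫ₗ LinearEquiv.ofEq _ _ ?_⟩
  rw [Submodule.localized'_eq_span]
  exact IsLocalization.map_under M B I

end Pic

/-- The ring `D[√g]`, free of rank two over `D`. -/
abbrev AdjoinSqrt {D : Type*} [CommRing D] (g : D) : Type _ :=
  AdjoinRoot ((X : D[X]) ^ 2 - C g)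

namespace AdjoinSqrt

open AdjoinRoot (of root)

variable {D : Type*} [CommRing D] {g : D}

theorem root_sq : (root _ : AdjoinSqrt g) ^ 2 = of _ g := by
  have h := AdjoinRoot.eval₂_root ((X : D[X]) ^ 2 - C g)
  rwa [eval₂_sub, eval₂_X_pow, eval₂_C, sub_eq_zero] at h

theorem exists_eq_of_add_of_mul_root (z : AdjoinSqrt g) :
    ∃ a b : D, z = of _ a + of _ b * root _ := by
  rcases subsingleton_or_nontrivial D with _ | _
  · have : Subsingleton (AdjoinSqrt g) := Module.subsingleton D _
    exact ⟨0, 0, Subsingleton.elim _ _⟩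
  have hmonic : ((X : D[X]) ^ 2 - C g).Monic := monic_X_pow_sub_C g two_ne_zero
  obtain ⟨p, rfl⟩ := AdjoinRoot.mk_surjective z
  have hdeg : (p %ₘ (X ^ 2 - C g)).degree < 2 :=
    (degree_modByMonic_lt p hmonic).trans_eq (degree_X_pow_sub_C two_pos g)
  refine ⟨(p %ₘ (X ^ 2 - C g)).coeff 0, (p %ₘ (X ^ 2 - C g)).coeff 1, ?_⟩
  rw [← AdjoinRoot.mk_leftInverse hmonic (AdjoinRoot.mk _ p), AdjoinRoot.modByMonicHom_mk]
  conv_lhs => rw [eq_X_add_C_of_degree_le_one (Order.le_of_lt_succ hdeg)]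
  rw [map_add, map_mul, AdjoinRoot.mk_C, AdjoinRoot.mk_C, AdjoinRoot.mk_X, add_comm]

theorem of_add_of_mul_root_eq_zero_iff {a b : D} :
    (of _ a + of _ b * root _ : AdjoinSqrt g) = 0 ↔ a = 0 ∧ b = 0 := by
  refine ⟨fun h => ?_, by rintro ⟨rfl, rfl⟩; simp⟩
  nontriviality D
  have hlin : C b * X + C a = 0 := by
    by_contra hne
    refine AdjoinRoot.mk_ne_zero_of_degree_lt (monic_X_pow_sub_C g two_ne_zero) hne ?_ ?_
    · exact degree_linear_lt.trans_eq (degree_X_pow_sub_C two_pos g).symm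
    · rw [map_add, map_mul, AdjoinRoot.mk_C, AdjoinRoot.mk_C, AdjoinRoot.mk_X, add_comm, h]
  exact ⟨by simpa using congrArg (coeff · 0) hlin, by simpa using congrArg (coeff · 1) hlin⟩

theorem of_injective : Function.Injective (of ((X : D[X]) ^ 2 - C g)) := by
  rw [injective_iff_map_eq_zero]
  intro a ha
  exact (of_add_of_mul_root_eq_zero_iff (g := g) (b := 0).mp (by simp [ha])).1

theorem conj_mul_self (a b : D) :
    (of _ a - of _ b * root _ : AdjoinSqrt g) * (of _ a + of _ b * root _) =
      of _ (a ^ 2 - g * b ^ 2) := by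
  simp only [map_sub, map_mul, map_pow, ← root_sq]
  ring

theorem isDomain [IsDomain D] (hg : ∀ a b : D, a ^ 2 - g * b ^ 2 = 0 → a = 0 ∧ b = 0) :
    IsDomain (AdjoinSqrt g) := by
  have : Nontrivial (AdjoinSqrt g) := of_injective.nontrivial
  have : NoZeroDivisors (AdjoinSqrt g) := by
    refine ⟨fun {z w} h => or_iff_not_imp_left.mpr fun hz => ?_⟩
    obtain ⟨a, b, rfl⟩ := exists_eq_of_add_of_mul_root z
    obtain ⟨c, d, rfl⟩ := exists_eq_of_add_of_mul_root w
    have hnorm : a ^ 2 - g * b ^ 2 ≠ 0 := fun h0 =>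
      hz (of_add_of_mul_root_eq_zero_iff.mpr (hg a b h0))
    have hnw : (of _ ((a ^ 2 - g * b ^ 2) * c) + of _ ((a ^ 2 - g * b ^ 2) * d) * root _ :
        AdjoinSqrt g) = 0 := by
      rw [map_mul, map_mul, ← conj_mul_self]
      linear_combination (of _ a - of _ b * root _) * h
    rw [of_add_of_mul_root_eq_zero_iff, mul_eq_zero_iff_left hnorm,
      mul_eq_zero_iff_left hnorm] at hnw
    exact of_add_of_mul_root_eq_zero_iff.mpr hnw
  exact NoZeroDivisors.to_isDomain _

section PrimeIdeal

variable {P : Ideal (AdjoinSqrt g)} {π : D}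

theorem isPrincipalNear_self_of_dvd [hP : P.IsPrime] (hπ : ∀ d : D, of _ d ∈ P ↔ π ∣ d)
    (hg : Squarefree g) (hdvd : π ∣ g) : IsPrincipalNear P P := by
  obtain ⟨u, rfl⟩ := hdvd
  have hu : ¬ π ∣ u := fun hu => by
    have hone : of _ (1 : D) ∈ P := (hπ 1).mpr (hg π (mul_dvd_mul_left π hu)).dvd
    rw [map_one] at hone
    exact hP.one_notMem hone
  have hroot : root _ ∈ P :=
    hP.mem_of_pow_mem 2 (root_sq (g := π * u) ▸ (hπ _).mpr (dvd_mul_right π u))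
  refine ⟨root _, hroot, fun x hx => ⟨of _ u, fun h => hu ((hπ u).mp h), ?_⟩⟩
  obtain ⟨a, b, rfl⟩ := exists_eq_of_add_of_mul_root x
  obtain ⟨a', rfl⟩ := (hπ a).mp ((P.add_mem_iff_left (P.mul_mem_left _ hroot)).mp hx)
  refine ⟨root _ * of _ a' + of _ (u * b), ?_⟩
  have hsq := root_sq (g := π * u)
  simp only [map_mul] at hsq ⊢
  linear_combination (-of _ a') * hsq

theorem isPrincipalNear_self_of_root_sub_mem (hπ : ∀ d : D, of _ d ∈ P ↔ π ∣ d)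
    (h2 : IsUnit (2 : D)) (hdvd : ¬ π ∣ g) {c : D} (hc : root _ - of _ c ∈ P) :
    IsPrincipalNear P P := by
  have hnorm : π ∣ g - c ^ 2 := by
    rw [← hπ, map_sub, map_pow, ← root_sq, sq_sub_sq]
    exact P.mul_mem_left _ hc
  have hconj : root _ + of _ c ∉ P := fun h => by
    have h2c : of _ (2 * c) ∈ P := by
      have := sub_mem h hc
      rwa [add_sub_sub_cancel, ← two_mul, ← map_ofNat (of _), ← map_mul] at this
    have hdvd_c : π ∣ c := h2.dvd_mul_left.mp ((hπ _).mp h2c)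
    exact hdvd ((dvd_sub_left (hdvd_c.pow two_ne_zero)).mp hnorm)
  refine ⟨of _ π, (hπ π).mpr dvd_rfl, fun x hx => ⟨_, hconj, ?_⟩⟩
  obtain ⟨a, b, rfl⟩ := exists_eq_of_add_of_mul_root x
  have habc : π ∣ a + b * c := by
    have hab := sub_mem hx (P.mul_mem_left (of _ b) hc)
    rwa [mul_sub, sub_sub_eq_add_sub, add_right_comm, add_sub_cancel_right, ← map_mul, ← map_add,
      hπ] at hab
  have hx_eq : (root _ + of _ c : AdjoinSqrt g) * (of _ a + of _ b * root _) =
      of _ (a + b * c) * (root _ + of _ c) + of _ (g - c ^ 2) * of _ b := by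
    simp only [map_add, map_sub, map_mul, map_pow, ← root_sq]
    ring
  rw [hx_eq]
  exact dvd_add ((map_dvd (of _) habc).mul_right _) ((map_dvd (of _) hnorm).mul_right _)

theorem isPrincipalNear_self_of_forall_root_sub_notMem [hP : P.IsPrime]
    [hmax : (Ideal.span {π}).IsMaximal] (hπ : ∀ d : D, of _ d ∈ P ↔ π ∣ d)
    (h : ∀ c : D, root _ - of _ c ∉ P) :
    IsPrincipalNear P P := by
  refine ⟨of _ π, (hπ π).mpr dvd_rfl, fun x hx => ⟨1, hP.one_notMem, ?_⟩⟩
  obtain ⟨a, b, rfl⟩ := exists_eq_of_add_of_mul_root x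
  have hb : π ∣ b := by
    by_contra hb
    obtain ⟨s, i, hi, hs⟩ := hmax.exists_inv fun h => hb (Ideal.mem_span_singleton.mp h)
    have hiP : of _ i ∈ P := (hπ i).mpr (Ideal.mem_span_singleton.mp hi)
    have hroot : (root _ - of _ (-(s * a)) : AdjoinSqrt g) =
        of _ s * (of _ a + of _ b * root _) + of _ i * root _ := by
      replace hs := congrArg (of ((X : D[X]) ^ 2 - C g)) hs
      simp only [map_add, map_mul, map_neg, map_one] at hs ⊢
      linear_combination (-root _) * hs
    exact h _ (hroot ▸ add_mem (P.mul_mem_left _ hx) (P.mul_mem_right _ hiP))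
  have hbP : of _ b * root _ ∈ P := P.mul_mem_right _ ((hπ b).mpr hb)
  have ha : π ∣ a := (hπ a).mp ((P.add_mem_iff_left hbP).mp hx)
  rw [one_mul]
  exact dvd_add (map_dvd (of _) ha) ((map_dvd (of _) hb).mul_right _)

end PrimeIdeal

theorem isDedekindDomain [IsDomain D] [IsPrincipalIdealRing D] (h2 : IsUnit (2 : D))
    (hg : Squarefree g) [IsDomain (AdjoinSqrt g)] : IsDedekindDomain (AdjoinSqrt g) := by
  have : Module.Finite D (AdjoinSqrt g) := (monic_X_pow_sub_C g two_ne_zero).finite_adjoinRoot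
  have : IsNoetherianRing (AdjoinSqrt g) := .of_finite D _
  refine isDedekindDomain_of_isPrincipalNear_self fun P hP hP0 => ?_
  have hcomap : P.comap (of _) ≠ ⊥ := fun h => hP0 (Ideal.eq_bot_of_comap_eq_bot (R := D) h)
  have hprime : (P.comap (of _)).IsPrime := Ideal.comap_isPrime _ P
  obtain ⟨π, hspan⟩ := (IsPrincipalIdealRing.principal (P.comap (of _))).principal
  rw [Ideal.submodule_span_eq] at hspan
  have hmax : (Ideal.span {π}).IsMaximal := hspan ▸ hprime.isMaximal hcomap
  have hπ (d : D) : of _ d ∈ P ↔ π ∣ d := by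
    rw [← Ideal.mem_comap, hspan, Ideal.mem_span_singleton]
  -- `π` ramifies, splits, or is inert.
  by_cases hdvd : π ∣ g
  · exact isPrincipalNear_self_of_dvd hπ hg hdvd
  · by_cases hroot : ∃ c : D, root _ - of _ c ∈ P
    · obtain ⟨c, hc⟩ := hroot
      exact isPrincipalNear_self_of_root_sub_mem hπ h2 hdvd hc
    · exact isPrincipalNear_self_of_forall_root_sub_notMem hπ (not_exists.mp hroot)

end AdjoinSqrt

theorem isDedekindDomain_of_ringEquiv {A B : Type*} [CommRing A] [CommRing B] [IsDedekindDomain A]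
    (e : A ≃+* B) : IsDedekindDomain B := by
  have : IsDomain B := e.symm.toMulEquiv.isDomain A
  have : IsNoetherianRing B := isNoetherianRing_of_ringEquiv A e
  refine isDedekindDomain_of_isPrincipalNear_self fun P hP _ => ?_
  have h := (isPrincipalNear_of_isDedekindDomain (P.comap (e : A →+* B))
    (Ideal.comap_ne_top _ hP.ne_top)).map (e : A →+* B)
  rwa [Ideal.map_comap_of_surjective (e : A →+* B) e.surjective] at h

theorem eq_zero_of_sq_sub_mul_sq_eq_zero {T : Type*} [CommRing T] [IsDomain T] {g : T[X]}
    (hg : g.Monic) (hodd : Odd g.natDegree) (a b : T[X]) (h : a ^ 2 - g * b ^ 2 = 0) :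
    a = 0 ∧ b = 0 := by
  have hb : b = 0 := by
    by_contra hb
    have hdeg := congrArg natDegree (sub_eq_zero.mp h)
    rw [natDegree_mul hg.ne_zero (pow_ne_zero 2 hb), natDegree_pow, natDegree_pow] at hdeg
    obtain ⟨k, hk⟩ := hodd
    omega
  exact ⟨by simpa [hb] using h, hb⟩

theorem separable_map_of_discr_ne_zero {R k : Type*} [CommRing R] [Field k] {f : R[X]}
    (hf : f.Monic) (hdeg : 0 < f.natDegree) (φ : R →+* k) (h : φ f.discr ≠ 0) :
    (f.map φ).Separable := by
  obtain ⟨p, q, -, -, hpq⟩ := exists_mul_add_mul_eq_C_resultant f (derivative f)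
    (m := f.natDegree) (n := f.natDegree - 1) le_rfl (natDegree_derivative_le f)
    (Or.inl hdeg.ne')
  rw [resultant_deriv (natDegree_pos_iff_degree_pos.mp hdeg), hf.leadingCoeff, mul_one] at hpq
  have hunit : IsUnit (C (φ ((-1) ^ (f.natDegree * (f.natDegree - 1) / 2) * f.discr))) := by
    rw [isUnit_C, map_mul, map_pow, map_neg, map_one]
    exact (IsUnit.pow _ isUnit_one.neg).mul h.isUnit
  obtain ⟨u, hu⟩ := hunit.exists_left_inv
  replace hpq := congrArg (Polynomial.map φ) hpq
  rw [Polynomial.map_add, Polynomial.map_mul, Polynomial.map_mul, Polynomial.map_C,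
    ← derivative_map] at hpq
  exact ⟨u * p.map φ, u * q.map φ, by linear_combination u * hpq + hu⟩

namespace CurveRing

open AdjoinRoot (of root)

variable {R : Type*} [CommRing R] (f : R[X]) {T T' : Type*} [CommRing T] [CommRing T']
  [Algebra R T] [Algebra R T']

theorem isDomain [IsDomain T] (hf : f.Monic) (hodd : Odd f.natDegree) :
    IsDomain (CurveRing f T) :=
  AdjoinSqrt.isDomain
    (eq_zero_of_sq_sub_mul_sq_eq_zero (hf.map (algebraMap R T)) (by rwa [hf.natDegree_map]))

theorem isDedekindDomain {k : Type*} [Field k] [Algebra R k] (hf : f.Monic)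
    (hodd : Odd f.natDegree) (h2 : (2 : k) ≠ 0) (hsep : (f.map (algebraMap R k)).Separable) :
    IsDedekindDomain (CurveRing f k) := by
  have := isDomain f (T := k) hf hodd
  have htwo : IsUnit (2 : k[X]) := isUnit_C.mpr h2.isUnit
  exact AdjoinSqrt.isDedekindDomain htwo hsep.squarefree

theorem algebraMap_eq : algebraMap T (CurveRing f T) = (of _).comp C := rfl

theorem algebraMap_injective : Function.Injective (algebraMap T (CurveRing f T)) := by
  rw [algebraMap_eq, RingHom.coe_comp]
  exact AdjoinSqrt.of_injective.comp C_injective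

section map

variable (φ : T →ₐ[R] T')

theorem map_of_add_of_mul_root (p q : T[X]) :
    CurveRing.map f φ (of _ p + of _ q * root _) =
      of _ (p.map (φ : T →+* T')) + of _ (q.map (φ : T →+* T')) * root _ := by
  simp [CurveRing.map, AdjoinRoot.map]

theorem map_algebraMap (t : T) :
    CurveRing.map f φ (algebraMap T (CurveRing f T) t) =
      algebraMap T' (CurveRing f T') (φ t) := by
  have h := map_of_add_of_mul_root f φ (C t) 0
  rw [Polynomial.map_zero, map_zero, map_zero, zero_mul, zero_mul, add_zero, add_zero,
    Polynomial.map_C] at h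
  exact h

variable {φ}

theorem map_injective (hφ : Function.Injective φ) : Function.Injective (CurveRing.map f φ) := by
  rw [injective_iff_map_eq_zero]
  intro z hz
  obtain ⟨p, q, rfl⟩ := AdjoinSqrt.exists_eq_of_add_of_mul_root z
  rwa [map_of_add_of_mul_root, AdjoinSqrt.of_add_of_mul_root_eq_zero_iff,
    Polynomial.map_eq_zero_iff (f := (φ : T →+* T')) hφ,
    Polynomial.map_eq_zero_iff (f := (φ : T →+* T')) hφ,
    ← AdjoinSqrt.of_add_of_mul_root_eq_zero_iff] at hz

theorem map_surjective (hφ : Function.Surjective φ) :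
    Function.Surjective (CurveRing.map f φ) := by
  intro z
  obtain ⟨p, q, rfl⟩ := AdjoinSqrt.exists_eq_of_add_of_mul_root z
  obtain ⟨p, rfl⟩ := Polynomial.map_surjective (φ : T →+* T') hφ p
  obtain ⟨q, rfl⟩ := Polynomial.map_surjective (φ : T →+* T') hφ q
  exact ⟨_, map_of_add_of_mul_root f φ p q⟩

variable (φ)

theorem ker_map : RingHom.ker (CurveRing.map f φ) =
    (RingHom.ker (φ : T →+* T')).map (algebraMap T (CurveRing f T)) := by
  apply le_antisymm
  · intro z hz
    obtain ⟨p, q, rfl⟩ := AdjoinSqrt.exists_eq_of_add_of_mul_root z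
    rw [RingHom.mem_ker, map_of_add_of_mul_root, AdjoinSqrt.of_add_of_mul_root_eq_zero_iff,
      ← coe_mapRingHom, ← RingHom.mem_ker, ← RingHom.mem_ker, ker_mapRingHom] at hz
    rw [algebraMap_eq, ← Ideal.map_map]
    exact add_mem (Ideal.mem_map_of_mem _ hz.1)
      (Ideal.mul_mem_right _ _ (Ideal.mem_map_of_mem _ hz.2))
  · rw [Ideal.map_le_iff_le_comap]
    intro t ht
    have ht : φ t = 0 := ht
    rw [Ideal.mem_comap, RingHom.mem_ker, map_algebraMap, ht, map_zero]

end map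

theorem isLocalization_algebraMapSubmonoid [Algebra T T'] [IsFractionRing T T']
    (φ : T →ₐ[R] T') (hφ : ∀ t, φ t = algebraMap T T' t) :
    letI := (CurveRing.map f φ).toAlgebra
    IsLocalization (Algebra.algebraMapSubmonoid (CurveRing f T) T⁰) (CurveRing f T') := by
  let := (CurveRing.map f φ).toAlgebra
  have hφ' : (φ : T →+* T') = algebraMap T T' := RingHom.ext hφ
  have hinj : Function.Injective φ := funext hφ ▸ IsFractionRing.injective T T'
  have halg (z) : algebraMap (CurveRing f T) (CurveRing f T') z = CurveRing.map f φ z := rfl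
  refine ⟨⟨?_, fun z => ?_, fun hxy => ⟨1, by rw [map_injective f hinj hxy]⟩⟩⟩
  · rintro ⟨_, t, ht, rfl⟩
    rw [halg, map_algebraMap, hφ]
    exact (IsLocalization.map_units T' ⟨t, ht⟩).map (algebraMap T' (CurveRing f T'))
  · obtain ⟨p, q, rfl⟩ := AdjoinSqrt.exists_eq_of_add_of_mul_root z
    obtain ⟨d, hd, hdp⟩ := IsLocalization.integerNormalization_spec T⁰ p
    obtain ⟨e, he, heq⟩ := IsLocalization.integerNormalization_spec T⁰ q
    set p' := IsLocalization.integerNormalization T⁰ p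
    set q' := IsLocalization.integerNormalization T⁰ q
    refine ⟨⟨of _ (C e * p') + of _ (C d * q') * root _, ⟨_, d * e, mul_mem hd he, rfl⟩⟩, ?_⟩
    rw [halg, halg, map_algebraMap, map_of_add_of_mul_root, Polynomial.map_mul,
      Polynomial.map_mul, Polynomial.map_C, Polynomial.map_C, hφ', hdp, heq, hφ, algebraMap_eq,
      RingHom.comp_apply]
    simp only [Algebra.smul_def, Polynomial.algebraMap_apply, map_mul]
    ring

/-- Reduction modulo `p` identifies the fibre of the curve over `p` with the curve over `T ⧸ p`. -/
noncomputable def quotientMapEquiv (p : Ideal T) :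
    CurveRing f T ⧸ p.map (algebraMap T (CurveRing f T)) ≃+* CurveRing f (T ⧸ p) :=
  (Ideal.quotEquivOfEq <| by
    rw [ker_map]
    exact congrArg _ Ideal.mk_ker.symm).trans
    (RingHom.quotientKerEquivOfSurjective
      (map_surjective f (φ := Ideal.Quotient.mkₐ R p) Ideal.Quotient.mk_surjective))

theorem prime_algebraMap (hf : f.Monic) (hodd : Odd f.natDegree) {p : T}
    (hp : Prime p) : Prime (algebraMap T (CurveRing f T) p) := by
  have hp' : (Ideal.span {p}).IsPrime := (Ideal.span_singleton_prime hp.ne_zero).mpr hp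
  have := isDomain f (T := T ⧸ Ideal.span {p}) hf hodd
  have hp0 : algebraMap T (CurveRing f T) p ≠ 0 :=
    (map_ne_zero_iff _ (algebraMap_injective f)).mpr hp.ne_zero
  rw [← Ideal.span_singleton_prime hp0, ← Set.image_singleton, ← Ideal.map_span,
    ← Ideal.Quotient.isDomain_iff_prime]
  exact (quotientMapEquiv f (Ideal.span {p})).toMulEquiv.isDomain _

theorem isDedekindDomain_quotient_map {p : Ideal T} [p.IsMaximal] (hf : f.Monic)
    (hodd : Odd f.natDegree) (hp : algebraMap R T (2 * f.discr) ∉ p) :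
    IsDedekindDomain (CurveRing f T ⧸ p.map (algebraMap T (CurveRing f T))) := by
  let _ : Field (T ⧸ p) := Ideal.Quotient.field p
  have hne : algebraMap R (T ⧸ p) (2 * f.discr) ≠ 0 := mt Ideal.Quotient.eq_zero_iff_mem.mp hp
  rw [map_mul, map_ofNat] at hne
  have hsep := separable_map_of_discr_ne_zero hf hodd.pos _ (right_ne_zero_of_mul hne)
  have := isDedekindDomain f hf hodd (left_ne_zero_of_mul hne) hsep
  exact isDedekindDomain_of_ringEquiv (quotientMapEquiv f p).symm

end CurveRing

section Overring

open IsDedekindDomain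

variable {R K : Type*} [CommRing R] [IsDedekindDomain R] [Field K] [Algebra R K]
  [IsFractionRing R K]

/-- If `x = a / b` and `(a, b) J = (b)`, then `J` consists of denominators of `x` and
`J + x J = R`. -/
theorem exists_mul_add_eq_one_of_isFractionRing (x : K) :
    ∃ j k y z : R, algebraMap R K y = x * algebraMap R K j ∧
      algebraMap R K z = x * algebraMap R K k ∧ y + k = 1 := by
  obtain ⟨a, b, hb, rfl⟩ := IsFractionRing.div_surjective (A := R) x
  have hb0 : b ≠ 0 := nonZeroDivisors.ne_zero hb
  have hbK : algebraMap R K b ≠ 0 := by simpa using hb0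
  obtain ⟨J, hJ⟩ : Ideal.span {a, b} ∣ Ideal.span {b} :=
    Ideal.dvd_iff_le.mpr (Ideal.span_mono (by simp))
  have hdvd {i : R} (hi : i ∈ J) : b ∣ a * i :=
    Ideal.mem_span_singleton.mp
      (hJ ▸ Ideal.mul_mem_mul (Ideal.subset_span (Set.mem_insert a {b})) hi)
  have hbJ : b ∈ Ideal.span {a} * J ⊔ Ideal.span {b} * J := by
    rw [← Ideal.sup_mul, ← Ideal.span_insert, ← hJ]
    exact Ideal.mem_span_singleton_self b
  obtain ⟨_, haj, _, hbk, hjk⟩ := Submodule.mem_sup.mp hbJ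
  obtain ⟨j, hj, rfl⟩ := Ideal.mem_span_singleton_mul.mp haj
  obtain ⟨k, hk, rfl⟩ := Ideal.mem_span_singleton_mul.mp hbk
  obtain ⟨y, hy⟩ := hdvd hj
  obtain ⟨z, hz⟩ := hdvd hk
  refine ⟨j, k, y, z, ?_, ?_, mul_left_cancel₀ hb0 (by linear_combination hjk - hy)⟩
  · rw [div_mul_eq_mul_div, eq_div_iff hbK, ← map_mul, ← map_mul, hy, mul_comm]
  · rw [div_mul_eq_mul_div, eq_div_iff hbK, ← map_mul, ← map_mul, hz, mul_comm]

theorem map_comap_overring {T : Type*} [CommRing T] [Algebra R T] [Algebra T K]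
    [IsScalarTower R T K] [FaithfulSMul T K] (I : Ideal T) :
    (I.comap (algebraMap R T)).map (algebraMap R T) = I := by
  refine le_antisymm Ideal.map_comap_le fun x hx => ?_
  obtain ⟨j, k, y, z, hy, hz, hyk⟩ :=
    exists_mul_add_eq_one_of_isFractionRing (R := R) (algebraMap T K x)
  have hT {r s : R} (h : algebraMap R K r = algebraMap T K x * algebraMap R K s) :
      algebraMap R T r = x * algebraMap R T s := by
    rw [IsScalarTower.algebraMap_apply R T K, IsScalarTower.algebraMap_apply R T K,
      ← map_mul] at h
    exact FaithfulSMul.algebraMap_injective T K h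
  have hmem {r s : R} (h : algebraMap R T r = x * algebraMap R T s) :
      algebraMap R T r ∈ (I.comap (algebraMap R T)).map (algebraMap R T) :=
    Ideal.mem_map_of_mem _ (Ideal.mem_comap.mpr (h ▸ I.mul_mem_right _ hx))
  have hx_eq : x = x * algebraMap R T y + algebraMap R T z := by
    rw [hT hz, ← mul_add, ← map_add, hyk, map_one, mul_one]
  rw [hx_eq]
  exact add_mem (Ideal.mul_mem_left _ _ (hmem (hT hy))) (hmem (hT hz))

theorem isDedekindDomain_overring (R K T : Type*) [CommRing R] [IsDedekindDomain R] [Field K]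
    [Algebra R K] [IsFractionRing R K] [CommRing T] [Algebra R T] [Algebra T K]
    [IsScalarTower R T K] [FaithfulSMul T K] : IsDedekindDomain T := by
  have hmap (I : Ideal T) : (I.comap (algebraMap R T)).map (algebraMap R T) = I :=
    map_comap_overring (K := K) I
  have : IsDomain T := (FaithfulSMul.algebraMap_injective T K).isDomain
  have : IsNoetherianRing T := (isNoetherianRing_iff_ideal_fg T).mpr fun I => by
    rw [← hmap I]
    exact Ideal.FG.map (IsNoetherian.noetherian (I.comap (algebraMap R T))) _
  refine isDedekindDomain_of_isPrincipalNear_self fun P hP _ => ?_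
  have h := (isPrincipalNear_of_isDedekindDomain (P.comap (algebraMap R T))
    (Ideal.comap_ne_top _ hP.ne_top)).map (algebraMap R T)
  rwa [hmap] at h

theorem isFractionRing_overring (R K T : Type*) [CommRing R] [Field K] [Algebra R K]
    [IsFractionRing R K] [CommRing T] [Algebra R T] [Algebra T K] [IsScalarTower R T K]
    [FaithfulSMul T K] : IsFractionRing T K := by
  refine IsFractionRing.of_field T K fun x => ?_
  obtain ⟨a, b, -, rfl⟩ := IsFractionRing.div_surjective (A := R) x
  exact ⟨algebraMap R T a, algebraMap R T b, by simp only [← IsScalarTower.algebraMap_apply]⟩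

variable (K) in
theorem valuation_div_le_one_of_dvd_mul {w : HeightOneSpectrum R} {a b d : R} (hb : b ≠ 0)
    (hd : d ∉ w.asIdeal) (h : b ∣ d * a) :
    w.valuation K (algebraMap R K a / algebraMap R K b) ≤ 1 := by
  obtain ⟨c, hc⟩ := h
  have hbK : algebraMap R K b ≠ 0 := by simpa using hb
  have hc' : algebraMap R K d * (algebraMap R K a / algebraMap R K b) = algebraMap R K c := by
    rw [← mul_div_assoc, div_eq_iff hbK, ← map_mul, ← map_mul, hc, mul_comm]
  calc w.valuation K (algebraMap R K a / algebraMap R K b)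
      = w.valuation K (algebraMap R K d * (algebraMap R K a / algebraMap R K b)) := by
        rw [map_mul, w.valuation_eq_one_iff_notMem.mpr hd, one_mul]
    _ ≤ 1 := hc' ▸ w.valuation_le_one c

theorem algebraMap_dvd_integer {S : Set (HeightOneSpectrum R)} {v : HeightOneSpectrum R}
    (hv : v ∈ S) {b j : R} (hb : b ≠ 0) (h : ∀ d ∈ v.asIdeal, b ∣ d * j) :
    algebraMap R (S.integer K) b ∣ algebraMap R (S.integer K) j := by
  have hbK : algebraMap R K b ≠ 0 := by simpa using hb
  refine ⟨⟨algebraMap R K j / algebraMap R K b, fun w hw => ?_⟩,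
    Subtype.ext (mul_div_cancel₀ _ hbK).symm⟩
  obtain ⟨d, hdv, hdw⟩ : ∃ d ∈ v.asIdeal, d ∉ w.asIdeal := by
    by_contra! hle
    exact hw (HeightOneSpectrum.ext (v.isMaximal.eq_of_le w.isPrime.ne_top hle) ▸ hv)
  exact valuation_div_le_one_of_dvd_mul K hb hdw (h d hdv)

theorem notMem_of_asIdeal_le_comap_integer {S : Set (HeightOneSpectrum R)}
    {p : Ideal (S.integer K)} (hp : p ≠ ⊤) {v : HeightOneSpectrum R}
    (hv : v.asIdeal ≤ p.comap (algebraMap R (S.integer K))) : v ∉ S := by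
  intro hvS
  obtain ⟨b, hb, hb0⟩ := Submodule.exists_mem_ne_zero_of_ne_bot v.ne_bot
  obtain ⟨J, hJ⟩ := Ideal.dvd_span_singleton.mpr hb
  have hb0' : algebraMap R (S.integer K) b ≠ 0 := fun h =>
    hb0 ((IsFractionRing.injective R K).eq_iff' (map_zero _) |>.mp (congrArg Subtype.val h))
  have hle : v.asIdeal * J ≤
      (Ideal.span {algebraMap R (S.integer K) b} * p).comap (algebraMap R (S.integer K)) := by
    refine Ideal.mul_le.mpr fun x hx j hj => ?_
    rw [Ideal.mem_comap, map_mul, mul_comm (Ideal.span _)]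
    refine Ideal.mul_mem_mul (hv hx) (Ideal.mem_span_singleton.mpr ?_)
    refine algebraMap_dvd_integer hvS hb0 fun d hd => Ideal.mem_span_singleton.mp ?_
    exact hJ ▸ Ideal.mul_mem_mul hd hj
  obtain ⟨c, hc, hcb⟩ := Ideal.mem_span_singleton_mul.mp
    (hle (hJ ▸ Ideal.mem_span_singleton_self b))
  exact (Ideal.ne_top_iff_one p).mp hp (mul_eq_left₀ hb0' |>.mp hcb ▸ hc)

theorem exists_notMem_asIdeal_eq_comap_integer {S : Set (HeightOneSpectrum R)}
    {p : Ideal (S.integer K)} [hp : p.IsPrime] (hp0 : p ≠ ⊥) :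
    ∃ v ∉ S, v.asIdeal = p.comap (algebraMap R (S.integer K)) := by
  have hne : p.comap (algebraMap R (S.integer K)) ≠ ⊥ := fun h => hp0 <| by
    rw [← map_comap_overring (R := R) (K := K) p, h, Ideal.map_bot]
  exact ⟨⟨_, Ideal.comap_isPrime _ p, hne⟩,
    notMem_of_asIdeal_le_comap_integer hp.ne_top le_rfl, rfl⟩

end Overring

theorem mainTheorem7_general {R K : Type*} [CommRing R] [IsDedekindDomain R] [Field K]
    [Algebra R K] [IsFractionRing R K] (f : R[X]) (hf_monic : f.Monic)
    (hf_odd : Odd f.natDegree) (S : Set (IsDedekindDomain.HeightOneSpectrum R)) :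
    letI : Algebra (CurveRing f (S.integer K)) (CurveRing f K) :=
      (CurveRing.map f (S.integer K).val).toAlgebra
    ∃ θ : CommRing.Pic (CurveRing f (S.integer K)) →* CommRing.Pic (CurveRing f K),
      (∀ (M : Type*) [AddCommGroup M] [Module (CurveRing f (S.integer K)) M]
          [Module.Invertible (CurveRing f (S.integer K)) M],
        θ (CommRing.Pic.mk (CurveRing f (S.integer K)) M) =
          CommRing.Pic.mk (CurveRing f K)
            (CurveRing f K ⊗[CurveRing f (S.integer K)] M)) ∧
      ((∀ v : IsDedekindDomain.HeightOneSpectrum R,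
          v.asIdeal ∣ Ideal.span {2 * f.discr} → v ∈ S) → Function.Surjective θ) ∧
      (IsPrincipalIdealRing (S.integer K) → Function.Injective θ) := by
  let : Algebra (CurveRing f (S.integer K)) (CurveRing f K) :=
    (CurveRing.map f (S.integer K).val).toAlgebra
  have := isDedekindDomain_overring R K (S.integer K)
  have := isFractionRing_overring R K (S.integer K)
  have := CurveRing.isDomain f (T := S.integer K) hf_monic hf_odd
  have := CurveRing.isDomain f (T := K) hf_monic hf_odd
  have := CurveRing.isLocalization_algebraMapSubmonoid f (S.integer K).val fun _ => rfl
  refine ⟨CommRing.Pic.mapAlgebra _ _, fun M _ _ _ => pic_mapAlgebra_mk M,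
    fun hdisc => ?_, fun hpid => ?_⟩
  · refine pic_mapAlgebra_surjective (R := S.integer K) fun p hp hp0 => ?_
    have := hp.isMaximal hp0
    obtain ⟨v, hvS, hv⟩ := exists_notMem_asIdeal_eq_comap_integer hp0
    refine CurveRing.isDedekindDomain_quotient_map f hf_monic hf_odd fun hmem => hvS (hdisc v ?_)
    exact Ideal.dvd_span_singleton.mpr (hv ▸ Ideal.mem_comap.mpr hmem)
  · have : FaithfulSMul (S.integer K) (CurveRing f (S.integer K)) :=
      (faithfulSMul_iff_algebraMap_injective _ _).mpr (CurveRing.algebraMap_injective f)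
    have : FaithfulSMul (CurveRing f (S.integer K)) (CurveRing f K) :=
      (faithfulSMul_iff_algebraMap_injective _ _).mpr
        (CurveRing.map_injective f Subtype.val_injective)
    exact pic_mapAlgebra_injective (R := S.integer K)
      fun p hp => CurveRing.prime_algebraMap f hf_monic hf_odd hp

theorem mainTheorem7 {K : Type u} [Field K] [NumberField K] (f : (𝓞 K)[X])
    (hf_sqf : Squarefree f) (hf_monic : f.Monic) (hf_odd : Odd f.natDegree)
    (hf_deg : 3 ≤ f.natDegree)
    (S : Set (IsDedekindDomain.HeightOneSpectrum (𝓞 K))) (hS : S.Finite) :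
    letI : Algebra (CurveRing f (S.integer K)) (CurveRing f K) := (genericFibreHom f S).toAlgebra
    ∃ θ : CommRing.Pic (CurveRing f (S.integer K)) →* CommRing.Pic (CurveRing f K),
      (∀ (M : Type u) [AddCommGroup M] [Module (CurveRing f (S.integer K)) M]
          [Module.Invertible (CurveRing f (S.integer K)) M],
        θ (CommRing.Pic.mk (CurveRing f (S.integer K)) M) =
          CommRing.Pic.mk (CurveRing f K)
            (CurveRing f K ⊗[CurveRing f (S.integer K)] M)) ∧
      ((∀ v : IsDedekindDomain.HeightOneSpectrum (𝓞 K),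
          v.asIdeal ∣ Ideal.span {2 * f.discr} → v ∈ S) → Function.Surjective θ) ∧
      (IsPrincipalIdealRing (S.integer K) → Function.Injective θ) :=
  mainTheorem7_general f hf_monic hf_odd S
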